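/- **Setting.** Let $\Omega\subset\mathbb R^d$ be compact with $\Omega=\overline{\operatorname{int}\Omega}$, let $1<p<\infty$, $1/p+1/p'=1$, and $\langle f,g\rangle=\int_\Omega f\bar g\,dx$. Functions are complex valued unless said otherwise. $H^s(\Omega)$, $s\ge 0$, is the space of restrictions to $\Omega$ of elements of $H^s(\mathbb R^d)$ with the quotient norm $\|f\|_{H^s}=\inf\{\|g\|_{H^s(\mathbb R^d)}: g|_\Omega=f\}$, where $\|g\|_{H^s(\mathbb R^d)}=\|(1+|\xi|^2)^{s/2}\hat g\|_2$ and $\hat g(\xi)=\int g(x)e^{-2\pi i x\cdot\xi}dx$. *MRA.* Finite-dimensional spaces $V_0\subset V_1\subset\dots\subset C(\Omega)$ are given, with $1\in V_0$ and $\bigcup_jV_j$ dense in $L^p(\Omega)$. Each $V_j$ has a basis of nonnegative real functions $\phi_{j,0},\dots,\phi_{j,N_j}\in C^1(\Omega)$ such that $\phi_{j,k}$ is a real linear combination of the $\phi_{j+1,l}$, $2^{-dj/2}\sum_k\phi_{j,k}\equiv1$, and, uniformly in $j,k$: $\operatorname{diam}\operatorname{supp}\phi_{j,k}\le C'2^{-j}$,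 each $\operatorname{supp}\phi_{j,k'}$ meets at most $m$ of the sets $\operatorname{supp}\phi_{j,k}$, and $\|\nabla\phi_{j,k}\|_\infty\le C'2^{j(d/2+1)}$. There are dual functions $\tilde\phi_{j,k}\in L^2(\Omega)\cap L^{p'}(\Omega)$ with $\langle\phi_{j,k},\tilde\phi_{j,k'}\rangle=\delta_{kk'}$, and the projectors $P_jf=\sum_k\langle f,\tilde\phi_{j,k}\rangle\phi_{j,k}$ onto $V_j$ satisfy $P_jf\to f$ in $L^p(\Omega)$ for all $f\in L^p(\Omega)$. $\|P_j\|$ is the norm of $P_j$ as an operator on $C(\Omega)$ with the sup norm. *Wavelets.* - W1) There are finite sets $\mathcal J_j$, functions $\Psi_{j,k}\in V_{j+1}$ and $\tilde\Psi_{j,k}\in L^2(\Omega)$ ($j\ge0$, $k\in\mathcal J_j$) with $\langle\Psi_{j,k},\tilde\Psi_{j',k'}\rangle=\delta_{jj'}\delta_{kk'}$, $\langle\phi_{j,k},\tilde\Psi_{j',k'}\rangle=0$ for $j\le j'$, $\langle\Psi_{j,k},\tilde\phi_{j',k'}\rangle=0$ for $j'\le j$, and, for all $J\ge 0$ and $f\in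 L^2(\Omega)$, $f=P_Jf+\sum_{j\ge J}\sum_{k\in\mathcal J_j}\langle f,\tilde\Psi_{j,k}\rangle\Psi_{j,k}$ with convergence in $L^2(\Omega)$. - W2) (for given $s$ and $J$, with constants $c_1,c_2>0$) A function $f\in L^2(\Omega)$ is in $H^s(\Omega)$ if and only if $\sum_{j\ge J,k}2^{2sj}|\langle f,\tilde\Psi_{j,k}\rangle|^2<\infty$, and then $c_1\|f\|_{H^s}\le\|P_Jf\|_2+\bigl(\sum_{j\ge J,k}2^{2sj}|\langle f,\tilde\Psi_{j,k}\rangle|^2\bigr)^{1/2}\le c_2\|f\|_{H^s}$. - W3) $\|\Psi_{j,k}\|_\infty\le C_\Psi2^{dj/2}$ and $\#\mathcal J_j\le C_{\mathcal J}2^{dj}$. - W4) $\int_\Omega\Psi_{j,k}=0$ for all $j,k$. *Sampling.* Points $X=(x_0,\dots,x_M)$ in $\Omega$ are $\Delta$-dense if the open balls $B_{1/\Delta}(x_\ell)$ cover $\Omega$. Let $\psi_0,\dots,\psi_M\in L^\infty(\Omega)$ satisfy $0\le\psi_\ell\le1$, $\psi_\ell=0$ outside $B_{1/\Delta}(x_\ell)$,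 $\sum_\ell\psi_\ell=1$ (almost everywhere), and put $Qf=\sum_\ell f(x_\ell)\psi_\ell$. *The procedure* $\mathrm{INTEGRATE}[n,\mathbf y]$ at level $J$, for $\mathbf y\in\mathbb C^{M+1}$: let $\mathbf M=(\langle\psi_\ell,\tilde\phi_{J,k}\rangle)_{k,\ell}$, $\mathbf\Phi=(\phi_{J,k}(x_\ell))_{\ell,k}$, $\omega=(\int_\Omega\phi_{J,k})_k$. Start with $\mathrm{int}=\omega^T\mathbf M\mathbf y$, $\mathbf v=\mathbf\Phi\mathbf M\mathbf y$; then repeat $n+1$ times: $\mathrm{int}\leftarrow\mathrm{int}+\omega^T\mathbf M(\mathbf y-\mathbf v)$, followed by $\mathbf v\leftarrow\mathbf v+\mathbf\Phi\mathbf M(\mathbf y-\mathbf v)$. Return $\mathrm{int}$. Write $\mathrm{INTEGRATE}[\infty,\mathbf y]$ for its limit as $n\to\infty$, and $\mathbf f^s=(f(x_0),\dots,f(x_M))$. **Proposition.** Let $s>3d/2$. There is a constant $C>0$, depending only on $d$, $s$ and the constants $c_2,C_\Psi,C_{\mathcal J}$, such that the following holds for all $\Omega$, $p$, MRA and wavelets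 as above satisfying W1, W3 and W4, and for every $J\ge0$ for which W2 holds for $s$ at level $J$ with some $c_1$ and the given $c_2$. There are $\Delta_J>0$ and $\eta_0\in(0,1)$ such that, for every $\Delta\ge\Delta_J$, every $\Delta$-dense $X$ and all $\psi_\ell$ as above, the estimate $$\|(I-P_JQ)g\|_\infty\le\eta\|g\|_\infty\quad\text{for all }g\in V_J\qquad(*)$$ holds with $\eta=\eta_0$; and, for every $\eta\in(0,1)$ for which $(*)$ holds, every $f\in H^s(\Omega)$ has a continuous representative, for which $\mathrm{INTEGRATE}[\infty,\mathbf f^s]$ exists and $$\Bigl|\mathrm{INTEGRATE}[\infty,\mathbf f^s]-\int_\Omega f\,dx\Bigr|\le C\,\frac{|\Omega|\,\|P_J\|}{1-\eta}\,\|f\|_{H^s}\,\frac{2^{(\frac{3d}2-s)(J+1)}}{1-2^{\frac{3d}2-s}}.$$ -/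

import Mathlib

open MeasureTheory Filter Topology
open scoped ENNReal SchwartzMap ComplexConjugate

noncomputable section

/-- Euclidean space `ℝ^d`. -/
abbrev Euc (d : ℕ) : Type := EuclideanSpace ℝ (Fin d)

namespace BoundedSampling

open TopologicalSpace (Compacts)

/-! ### Function spaces on a compact set `Ω ⊂ ℝ^d`

Functions on `Ω` are functions on the subtype, `volume` is Lebesgue measure on `Ω`, and `C(Ω, ℂ)`
carries the supremum norm. -/

/-- Lebesgue measure on `Ω`. -/
instance instMeasureSpace {d : ℕ} (Ω : Compacts (Euc d)) : MeasureSpace Ω where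
  volume := Measure.comap Subtype.val (volume : Measure (Euc d))

theorem volume_univ {d : ℕ} (Ω : Compacts (Euc d)) :
    (volume : Measure Ω) Set.univ = volume (Ω : Set (Euc d)) := by
  have h := comap_subtype_coe_apply (Ω.isCompact.isClosed.measurableSet)
    (volume : Measure (Euc d)) Set.univ
  rw [Set.image_univ, Subtype.range_coe] at h
  exact h

instance instFiniteVolume {d : ℕ} (Ω : Compacts (Euc d)) :
    IsFiniteMeasure (volume : Measure Ω) := by
  constructor
  rw [volume_univ]
  exact Ω.isCompact.measure_lt_top

/-- A real continuous function regarded as a complex one. -/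
def toComplex {d : ℕ} {Ω : Compacts (Euc d)} (u : C(Ω, ℝ)) : C(Ω, ℂ) :=
  ⟨fun x => (u x : ℂ), Complex.continuous_ofReal.comp u.continuous⟩

/-- `u` is differentiable at all interior points of `Ω` and its gradient extends to the continuous
function `G` on `Ω`. So `u ∈ C¹(Ω)` if and only if such a `G` exists, and then `‖∇u‖_∞ = ‖G‖`. -/
def HasGradientOn {d : ℕ} {Ω : Compacts (Euc d)} (u : C(Ω, ℝ)) (G : C(Ω, Euc d)) : Prop :=
  ∀ x : Ω, (x : Euc d) ∈ interior (Ω : Set (Euc d)) →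
    HasGradientAt (Function.extend Subtype.val u 0) (G x) (x : Euc d)

/-- The pairing `⟨f, g⟩ = ∫_Ω f \bar g`. -/
def pairing {d : ℕ} {Ω : Compacts (Euc d)} (f g : Ω → ℂ) : ℂ := ∫ x, f x * conj (g x)

/-- The `H^s(ℝ^d)`-norms of the extensions to `ℝ^d` of the function `f` on `Ω`: the `H^s(ℝ^d)`-norm
of `g` is the `L²`-norm of `h = 𝓕⁻¹ ((1 + |ξ|²)^(s/2) 𝓕 g)`. -/
def extensionNorms {d : ℕ} {Ω : Compacts (Euc d)} (s : ℝ) (f : Ω → ℂ) : Set ℝ :=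
  {r | ∃ g h : Lp ℂ 2 (volume : Measure (Euc d)),
    TemperedDistribution.besselPotential (Euc d) ℂ s (g : 𝓢'(Euc d, ℂ)) = (h : 𝓢'(Euc d, ℂ)) ∧
    (fun x : Ω => g (x : Euc d)) =ᵐ[volume] f ∧ r = ‖h‖}

/-- `f ∈ H^s(Ω)` (for `s ≥ 0`): `f` is the restriction to `Ω` of an element of `H^s(ℝ^d)`. -/
def MemHs {d : ℕ} {Ω : Compacts (Euc d)} (s : ℝ) (f : Ω → ℂ) : Prop :=
  (extensionNorms s f).Nonempty

/-- The norm of `H^s(Ω)`: the infimum of the `H^s(ℝ^d)`-norms of all extensions. -/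
def hsNorm {d : ℕ} {Ω : Compacts (Euc d)} (s : ℝ) (f : Ω → ℂ) : ℝ := sInf (extensionNorms s f)

/-! ### Multiresolution analyses -/

/-- A multiresolution analysis of `L^p(Ω)` together with the biorthogonal dual functions
`φ~_{j,k}` that define the projectors `P_j f = ∑_k ⟨f, φ~_{j,k}⟩ φ_{j,k}`. -/
structure MRA {d : ℕ} (Ω : Compacts (Euc d)) (p : ℝ≥0∞) where
  /-- the multiresolution spaces `V_j(Ω)` -/
  V : ℕ → Submodule ℂ C(Ω, ℂ)
  /-- `V_j` has dimension `N_j + 1` -/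
  N : ℕ → ℕ
  /-- the basis functions `φ_{j,k}`, `k = 0, …, N_j` -/
  phi : (j : ℕ) → Fin (N j + 1) → C(Ω, ℝ)
  /-- the dual functions -/
  phiDual : (j : ℕ) → Fin (N j + 1) → Ω → ℂ
  -- the spaces are nested, contain the constants, and exhaust `L^p(Ω)`
  one_mem : (1 : C(Ω, ℂ)) ∈ V 0
  mono : ∀ j, V j ≤ V (j + 1)
  dense : ∀ f : Ω → ℂ, MemLp f p volume → ∀ ε : ℝ≥0∞, 0 < ε →
    ∃ j, ∃ g ∈ V j, eLpNorm (f - ⇑g) p volume < ε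
  -- the bases
  linearIndependent : ∀ j, LinearIndependent ℂ (fun k => toComplex (phi j k))
  span_eq : ∀ j, Submodule.span ℂ (Set.range fun k => toComplex (phi j k)) = V j
  nonneg : ∀ j k x, 0 ≤ phi j k x
  refinement : ∀ j, ∃ A : Matrix (Fin (N j + 1)) (Fin (N (j + 1) + 1)) ℝ,
    ∀ k, phi j k = ∑ l, A k l • phi (j + 1) l
  sum_eq_one : ∀ (j : ℕ) x, (2 : ℝ) ^ (-((d : ℝ) * j / 2)) * ∑ k, phi j k x = 1
  diam_support : ∃ C : ℝ, ∀ (j : ℕ) k, Metric.diam (tsupport (phi j k)) ≤ C * (2 : ℝ) ^ (-(j : ℝ))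
  overlap : ∃ m : ℕ, ∀ j k',
    Nat.card {k // (tsupport (phi j k) ∩ tsupport (phi j k')).Nonempty} ≤ m
  gradient : ∃ C : ℝ, ∀ (j : ℕ) k, ∃ G : C(Ω, Euc d), HasGradientOn (phi j k) G ∧
    ‖G‖ ≤ C * (2 : ℝ) ^ ((j : ℝ) * ((d : ℝ) / 2 + 1))
  -- the projectors
  phiDual_memLp_two : ∀ j k, MemLp (phiDual j k) 2 volume
  phiDual_memLp : ∀ j k, MemLp (phiDual j k) p.conjExponent volume
  biorthogonal : ∀ j k k',
    pairing (toComplex (phi j k)) (phiDual j k') = if k = k' then 1 else 0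
  tendsto_proj : ∀ f : Ω → ℂ, MemLp f p volume →
    Tendsto (fun j => eLpNorm
      (f - ⇑(∑ k, pairing f (phiDual j k) • toComplex (phi j k))) p volume) atTop (𝓝 0)

namespace MRA

variable {d : ℕ} {Ω : Compacts (Euc d)} {p : ℝ≥0∞} (A : MRA Ω p)

/-- `P_j f = ∑_k ⟨f, φ~_{j,k}⟩ φ_{j,k}`. -/
def proj (j : ℕ) (f : Ω → ℂ) : C(Ω, ℂ) :=
  ∑ k, pairing f (A.phiDual j k) • toComplex (A.phi j k)

/-- Integration against a fixed `L²` function is a bounded functional on `C(Ω)`. -/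
theorem integrable_pairing (j : ℕ) (k : Fin (A.N j + 1)) (f : C(Ω, ℂ)) :
    Integrable (fun x => f x * conj (A.phiDual j k x)) volume := by
  have h1 : Integrable (A.phiDual j k) volume :=
    (A.phiDual_memLp_two j k).integrable (by norm_num)
  have h2 : Integrable (fun x => conj (A.phiDual j k x)) volume :=
    Complex.conjLIE.toContinuousLinearEquiv.toContinuousLinearMap.integrable_comp h1
  exact h2.bdd_mul f.continuous.aestronglyMeasurable (Eventually.of_forall f.norm_coe_le_norm)

/-- The functional `f ↦ ⟨f, φ~_{j,k}⟩` on `C(Ω)`. -/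
def coeffL (j : ℕ) (k : Fin (A.N j + 1)) : C(Ω, ℂ) →L[ℂ] ℂ :=
  LinearMap.mkContinuous
    { toFun := fun f => pairing f (A.phiDual j k)
      map_add' := fun f g => by
        simp only [pairing, ContinuousMap.add_apply, add_mul]
        exact integral_add (A.integrable_pairing j k f) (A.integrable_pairing j k g)
      map_smul' := fun c f => by
        simp only [pairing, ContinuousMap.smul_apply, smul_eq_mul, mul_assoc, RingHom.id_apply]
        exact integral_const_mul c _ }
    (∫ x, ‖A.phiDual j k x‖)
    (fun f => by
      have h1 : Integrable (A.phiDual j k) volume :=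
        (A.phiDual_memLp_two j k).integrable (by norm_num)
      change ‖∫ x, f x * conj (A.phiDual j k x)‖ ≤ _
      rw [mul_comm, ← integral_const_mul]
      refine norm_integral_le_of_norm_le (h1.norm.const_mul _) (Eventually.of_forall fun x => ?_)
      rw [norm_mul, RCLike.norm_conj]
      exact mul_le_mul_of_nonneg_right (f.norm_coe_le_norm x) (norm_nonneg _))

/-- `P_j` as a bounded operator on `C(Ω)`; `‖A.projL j‖` is the operator norm `‖P_j‖`. -/
def projL (j : ℕ) : C(Ω, ℂ) →L[ℂ] C(Ω, ℂ) :=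
  ∑ k, (A.coeffL j k).smulRight (toComplex (A.phi j k))

theorem projL_apply (j : ℕ) (f : C(Ω, ℂ)) : A.projL j f = A.proj j f := by
  simp [projL, proj, coeffL]

end MRA

/-! ### Sampling and the iterative integration procedure -/

/-- The nodes `x_0, …, x_M` in `Ω` are `Δ`-dense. -/
def IsDeltaDense {d : ℕ} {Ω : Compacts (Euc d)} (Δ : ℝ) {M : ℕ} (X : Fin (M + 1) → Ω) : Prop :=
  (Ω : Set (Euc d)) = (⋃ l, Metric.ball (X l : Euc d) Δ⁻¹) ∩ (Ω : Set (Euc d))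

/-- `ψ_0, …, ψ_M ∈ L^∞(Ω)` is a partition of unity with values in `[0, 1]` such that `ψ_l` is
supported in the ball of radius `1/Δ` centered at `x_l`. -/
structure IsPartition {d : ℕ} {Ω : Compacts (Euc d)} (Δ : ℝ) {M : ℕ} (X : Fin (M + 1) → Ω)
    (ψ : Fin (M + 1) → Ω → ℝ) : Prop where
  aestronglyMeasurable : ∀ l, AEStronglyMeasurable (ψ l) volume
  mem_Icc : ∀ l, ∀ᵐ x, ψ l x ∈ Set.Icc (0 : ℝ) 1
  support : ∀ l, ∀ᵐ x : Ω, ψ l x ≠ 0 → (x : Euc d) ∈ Metric.ball (X l : Euc d) Δ⁻¹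
  sum_eq_one : ∀ᵐ x, ∑ l, ψ l x = 1

/-- The quasi-interpolant `Q f = ∑_l f(x_l) ψ_l`. -/
def quasiInterp {d : ℕ} {Ω : Compacts (Euc d)} {M : ℕ} (X : Fin (M + 1) → Ω)
    (ψ : Fin (M + 1) → Ω → ℝ) (f : Ω → ℂ) : Ω → ℂ :=
  fun x => ∑ l, f (X l) * (ψ l x : ℂ)

namespace MRA

variable {d : ℕ} {Ω : Compacts (Euc d)} {p : ℝ≥0∞} (A : MRA Ω p)

/-- `‖(I - P_j Q) f‖_∞ ≤ η ‖f‖_∞` for all `f ∈ V_j(Ω)`. -/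
def Contracts (j : ℕ) {M : ℕ} (X : Fin (M + 1) → Ω) (ψ : Fin (M + 1) → Ω → ℝ) (η : ℝ) : Prop :=
  ∀ f ∈ A.V j, ‖f - A.proj j (quasiInterp X ψ f)‖ ≤ η * ‖f‖

/-- The matrix `M_{ψ φ~} = (⟨ψ_l, φ~_{j,k}⟩)_{k,l}`. -/
def psiMatrix (j : ℕ) {M : ℕ} (ψ : Fin (M + 1) → Ω → ℝ) :
    Matrix (Fin (A.N j + 1)) (Fin (M + 1)) ℂ :=
  Matrix.of fun k l => pairing (fun x => (ψ l x : ℂ)) (A.phiDual j k)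

/-- The matrix `(φ_{j,k}(x_l))_{l,k}`. -/
def phiMatrix (j : ℕ) {M : ℕ} (X : Fin (M + 1) → Ω) :
    Matrix (Fin (M + 1)) (Fin (A.N j + 1)) ℂ :=
  Matrix.of fun l k => (A.phi j k (X l) : ℂ)

/-- The vector `ω_j` of the integrals `∫_Ω φ_{j,k}`. -/
def omega (j : ℕ) : Fin (A.N j + 1) → ℂ := fun k => ∫ x, (A.phi j k x : ℂ)

/-- `PQ_s`, acting on vectors of samples. -/
def pqs (j : ℕ) {M : ℕ} (X : Fin (M + 1) → Ω) (ψ : Fin (M + 1) → Ω → ℝ)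
    (v : Fin (M + 1) → ℂ) : Fin (M + 1) → ℂ :=
  (A.phiMatrix j X).mulVec ((A.psiMatrix j ψ).mulVec v)

/-- `ω_jᵀ M_{ψ φ~} v`. -/
def quad (j : ℕ) {M : ℕ} (ψ : Fin (M + 1) → Ω → ℝ) (v : Fin (M + 1) → ℂ) : ℂ :=
  dotProduct (A.omega j) ((A.psiMatrix j ψ).mulVec v)

/-- The pair of variables `(int, f^s)` of the integration procedure with input samples `y`, after
`i` passes through its loop. -/
def state (j : ℕ) {M : ℕ} (X : Fin (M + 1) → Ω) (ψ : Fin (M + 1) → Ω → ℝ)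
    (y : Fin (M + 1) → ℂ) : ℕ → ℂ × (Fin (M + 1) → ℂ)
  | 0 => (A.quad j ψ y, A.pqs j X ψ y)
  | i + 1 =>
    ((state j X ψ y i).1 + A.quad j ψ (y - (state j X ψ y i).2),
     (state j X ψ y i).2 + A.pqs j X ψ (y - (state j X ψ y i).2))

/-- `INTEGRATE[n, y]`: the loop `i := 0; while i ≤ n do i := i + 1; …` runs `n + 1` times. -/
def integrate (j : ℕ) {M : ℕ} (X : Fin (M + 1) → Ω) (ψ : Fin (M + 1) → Ω → ℝ) (n : ℕ)
    (y : Fin (M + 1) → ℂ) : ℂ :=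
  (A.state j X ψ y (n + 1)).1

/-! ### Wavelets -/

/-- W1: a biorthogonal wavelet basis associated to the multiresolution analysis, with index sets
`𝒥_j = {0, …, card j - 1}`. -/
structure WaveletBasis where
  /-- the cardinality of `𝒥_j` -/
  card : ℕ → ℕ
  /-- the wavelets `Ψ_{j,k}` -/
  psi : (j : ℕ) → Fin (card j) → C(Ω, ℂ)
  /-- the dual wavelets -/
  psiDual : (j : ℕ) → Fin (card j) → Ω → ℂ
  psi_mem : ∀ j k, psi j k ∈ A.V (j + 1)
  psiDual_memLp : ∀ j k, MemLp (psiDual j k) 2 volume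
  psi_psiDual : ∀ j k j' k',
    pairing (psi j k) (psiDual j' k') = if j = j' ∧ (k : ℕ) = k' then 1 else 0
  phi_psiDual : ∀ j k j' k', j ≤ j' → pairing (toComplex (A.phi j k)) (psiDual j' k') = 0
  psi_phiDual : ∀ j k j' k', j' ≤ j → pairing (psi j k) (A.phiDual j' k') = 0
  -- `f = P_J f + ∑_{j ≥ J} ∑_k ⟨f, Ψ~_{j,k}⟩ Ψ_{j,k}` in `L²(Ω)`
  expansion : ∀ (J : ℕ) (f : Ω → ℂ), MemLp f 2 volume →
    Tendsto (fun n => eLpNorm (f - ⇑(A.proj J f +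
      ∑ j ∈ Finset.Ico J n, ∑ k, pairing f (psiDual j k) • psi j k)) 2 volume) atTop (𝓝 0)

namespace WaveletBasis

variable {A} (W : A.WaveletBasis)

/-- `2^{2 s j} ∑_k |⟨f, Ψ~_{j,k}⟩|²`. -/
def levelEnergy (s : ℝ) (f : Ω → ℂ) (j : ℕ) : ℝ :=
  (2 : ℝ) ^ (2 * s * j) * ∑ k, ‖pairing f (W.psiDual j k)‖ ^ 2

/-- W2, at the level `J`: a function `f ∈ L²(Ω)` belongs to `H^s(Ω)` if and only if
`∑_{j ≥ J, k} 2^{2 s j} |⟨f, Ψ~_{j,k}⟩|²` is finite, and then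
`c₁ ‖f‖_{H^s} ≤ ‖P_J f‖_2 + (∑_{j ≥ J, k} 2^{2 s j} |⟨f, Ψ~_{j,k}⟩|²)^{1/2} ≤ c₂ ‖f‖_{H^s}`. -/
def W2 (s c₁ c₂ : ℝ) (J : ℕ) : Prop :=
  0 < c₁ ∧ 0 < c₂ ∧ ∀ f : Ω → ℂ, MemLp f 2 volume →
    (MemHs s f ↔ Summable fun i => W.levelEnergy s f (J + i)) ∧
    (MemHs s f →
      c₁ * hsNorm s f ≤ (eLpNorm (⇑(A.proj J f)) 2 volume).toReal +
        Real.sqrt (∑' i, W.levelEnergy s f (J + i)) ∧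
      (eLpNorm (⇑(A.proj J f)) 2 volume).toReal +
        Real.sqrt (∑' i, W.levelEnergy s f (J + i)) ≤ c₂ * hsNorm s f)

/-- W3. -/
def W3 (CΨ CJ : ℝ) : Prop :=
  (∀ (j : ℕ) k, ‖W.psi j k‖ ≤ CΨ * (2 : ℝ) ^ ((d : ℝ) * j / 2)) ∧
  (∀ j : ℕ, (W.card j : ℝ) ≤ CJ * (2 : ℝ) ^ ((d : ℝ) * j))

/-- W4. -/
def W4 : Prop := ∀ j k, ∫ x, W.psi j k x = 0

end WaveletBasis

end MRA

end BoundedSampling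

end

/-! ### Measure, integration and approximation on `Ω` -/

namespace BoundedSampling

open TopologicalSpace (Compacts)

variable {d : ℕ} {Ω : Compacts (Euc d)} {p : ℝ≥0∞}

/-! Write `f = q + e` with `q = P_J f` and `e` the sum of all wavelet levels `j ≥ J`. The wavelets
have mean zero, so `∫ f = ∫ q`, and only the effect of the samples of `e` on the procedure has to be
estimated.

Let `R y = P_J (∑ y_l ψ_l)` and let `S` denote sampling at the nodes. In function form the procedure
is `u_{i+1} = u_i + R (y - S u_i)` in `V_J`, and `int` is the integral of `u_i` (`state_eq`). By (*)
the map `I - R S` contracts `V_J` by `η`, so the `u_i` converge. With `y = S (q + e)` one has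
`u_{i+1} - q = (I - R S)(u_i - q) + R S e`. Since `‖R S e‖ ≤ ‖P_J‖ ‖e‖`, the limit is within `‖P_J‖
‖e‖ / (1 - η)` of `q` (`tendsto_iterate`), and integration costs a factor `|Ω|`.

The size of `e` comes from Cauchy-Schwarz on each level together with W2 and W3, followed by a
geometric series (`norm_level_le`, `exists_remainder`). The series converges uniformly, which also
gives the continuous representative.

For (*), the unit ball of the finite-dimensional `V_J` is equicontinuous, so `Q f` is uniformly
close to `f` when the balls are small. The projector `P_J` fixes `f` and is bounded on `L^∞`
(`norm_proj_le`, `exists_contracts`). -/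

theorem volume_real_univ (Ω : Compacts (Euc d)) :
    (volume : Measure Ω).real Set.univ = volume.real (Ω : Set (Euc d)) := by
  rw [measureReal_def, measureReal_def, volume_univ]

theorem memLp_of_memHs {s : ℝ} {f : Ω → ℂ} (hf : MemHs s f) : MemLp f 2 volume := by
  obtain ⟨r, g, h, -, hg, -⟩ := hf
  have hemb : MeasurableEmbedding (Subtype.val : Ω → Euc d) :=
    MeasurableEmbedding.subtype_coe Ω.isCompact.isClosed.measurableSet
  refine MemLp.ae_eq hg ?_
  have h1 : MemLp (⇑g) 2 (Measure.map (Subtype.val : Ω → Euc d) volume) := by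
    have h2 : Measure.map (Subtype.val : Ω → Euc d) volume =
        (volume : Measure (Euc d)).restrict (Set.range (Subtype.val : Ω → Euc d)) :=
      hemb.map_comap volume
    rw [h2]
    exact (Lp.memLp g).restrict _
  exact hemb.memLp_map_measure_iff.mp h1

theorem hsNorm_nonneg (s : ℝ) (f : Ω → ℂ) : 0 ≤ hsNorm s f := by
  refine Real.sInf_nonneg ?_
  rintro r ⟨g, h, -, -, rfl⟩
  exact norm_nonneg h

/-- As `Ω` is the closure of its interior, a nonempty relatively open set contains a nonempty open
subset of `ℝ^d`. This makes continuous representatives unique. -/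
theorem isOpenPosMeasure (hΩ : closure (interior (Ω : Set (Euc d))) = (Ω : Set (Euc d))) :
    (volume : Measure Ω).IsOpenPosMeasure := by
  refine ⟨fun U hU ⟨x, hx⟩ h0 => ?_⟩
  obtain ⟨O, hO, rfl⟩ := isOpen_induced_iff.mp hU
  have hx' : (x : Euc d) ∈ closure (interior (Ω : Set (Euc d))) := by rw [hΩ]; exact x.2
  obtain ⟨y, hyO, hyI⟩ := mem_closure_iff.mp hx' O hO hx
  have h1 := comap_subtype_coe_apply (Ω.isCompact.isClosed.measurableSet)
    (volume : Measure (Euc d)) (Subtype.val ⁻¹' O)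
  have h2 : volume (O ∩ interior (Ω : Set (Euc d))) = 0 := by
    refine measure_mono_null ?_ (h1.symm.trans h0)
    rintro z ⟨hzO, hzI⟩
    exact ⟨⟨z, interior_subset hzI⟩, hzO, rfl⟩
  exact (hO.inter isOpen_interior).measure_ne_zero volume ⟨y, hyO, hyI⟩ h2

theorem integrable_coe (f : C(Ω, ℂ)) : Integrable (⇑f) (volume : Measure Ω) :=
  Integrable.of_bound f.continuous.aestronglyMeasurable ‖f‖ (Eventually.of_forall f.norm_coe_le_norm)

theorem norm_integral_coe_le (f : C(Ω, ℂ)) :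
    ‖∫ x, f x‖ ≤ volume.real (Ω : Set (Euc d)) * ‖f‖ := by
  have h := norm_integral_le_of_norm_le_const (μ := (volume : Measure Ω))
    (Eventually.of_forall f.norm_coe_le_norm)
  rwa [volume_real_univ, mul_comm] at h

/-- Integration over `Ω` as a bounded functional on `C(Ω)`. -/
noncomputable def integralL (Ω : Compacts (Euc d)) : C(Ω, ℂ) →L[ℂ] ℂ :=
  LinearMap.mkContinuous
    { toFun := fun f => ∫ x, f x
      map_add' := fun f g => integral_add (integrable_coe f) (integrable_coe g)
      map_smul' := fun c _ => integral_const_mul c _ }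
    (volume.real (Ω : Set (Euc d))) norm_integral_coe_le

theorem integralL_apply (f : C(Ω, ℂ)) : integralL Ω f = ∫ x, f x := rfl

theorem eLpNorm_coe_le (f : C(Ω, ℂ)) :
    eLpNorm (⇑f) 2 (volume : Measure Ω) ≤
      (volume : Measure Ω) Set.univ ^ ((2 : ℝ≥0∞).toReal⁻¹) * ENNReal.ofReal ‖f‖ :=
  eLpNorm_le_of_ae_bound (Eventually.of_forall f.norm_coe_le_norm)

/-- An `L²`-limit of a uniformly convergent sequence is its uniform limit. -/
theorem ae_eq_of_tendsto {f : Ω → ℂ} (hf : AEStronglyMeasurable f volume) {S : ℕ → C(Ω, ℂ)}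
    {g : C(Ω, ℂ)} (hS : Tendsto S atTop (𝓝 g))
    (hSf : Tendsto (fun n => eLpNorm (f - ⇑(S n)) 2 volume) atTop (𝓝 0)) :
    ⇑g =ᵐ[volume] f := by
  have h0 : Tendsto (fun n => eLpNorm (⇑(S n - g)) 2 (volume : Measure Ω)) atTop (𝓝 0) := by
    have h1 : Tendsto (fun n => (volume : Measure Ω) Set.univ ^ ((2 : ℝ≥0∞).toReal⁻¹) *
        ENNReal.ofReal ‖S n - g‖) atTop (𝓝 0) := by
      have h2 : Tendsto (fun n => ‖S n - g‖) atTop (𝓝 0) := tendsto_iff_norm_sub_tendsto_zero.mp hS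
      have h3 := ENNReal.Tendsto.const_mul (a := (volume : Measure Ω) Set.univ ^
        ((2 : ℝ≥0∞).toReal⁻¹)) (ENNReal.tendsto_ofReal h2)
        (Or.inr (ENNReal.rpow_ne_top_of_nonneg (by simp) (measure_ne_top _ _)))
      simpa using h3
    exact tendsto_of_tendsto_of_tendsto_of_le_of_le tendsto_const_nhds h1
      (fun _ => zero_le) (fun n => eLpNorm_coe_le _)
  have h1 : eLpNorm (f - ⇑g) 2 volume ≤ 0 := by
    have h2 := hSf.add h0
    rw [add_zero] at h2
    refine ge_of_tendsto' h2 fun n => ?_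
    have h3 : f - ⇑g = (f - ⇑(S n)) + ⇑(S n - g) := by
      ext x; simp
    rw [h3]
    exact eLpNorm_add_le (hf.sub (S n).continuous.aestronglyMeasurable)
      (S n - g).continuous.aestronglyMeasurable (by norm_num)
  have h2 := (eLpNorm_eq_zero_iff (hf.sub g.continuous.aestronglyMeasurable) (by norm_num)).mp
    (le_antisymm h1 zero_le)
  filter_upwards [h2] with x hx
  exact (sub_eq_zero.mp hx).symm

/-- A bounded measurable function is an a.e. limit of continuous functions with the same bound. -/
theorem exists_seq_continuous_tendsto_ae {h : Ω → ℂ} (hm : AEStronglyMeasurable h volume) {c : ℝ}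
    (hc : 0 ≤ c) (hb : ∀ᵐ x, ‖h x‖ ≤ c) :
    ∃ g : ℕ → C(Ω, ℂ), (∀ n, ‖g n‖ ≤ c) ∧
      ∀ᵐ x, Tendsto (fun n => g n x) atTop (𝓝 (h x)) := by
  have hL : MemLp h 1 (volume : Measure Ω) := memLp_one_iff_integrable.mpr (Integrable.of_bound hm c hb)
  have hex : ∀ n : ℕ, ∃ g : BoundedContinuousFunction Ω ℂ,
      eLpNorm (h - ⇑g) 1 volume ≤ ENNReal.ofReal (1 / ((n : ℝ) + 1)) ∧ MemLp g 1 volume := fun n =>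
    hL.exists_boundedContinuous_eLpNorm_sub_le (by norm_num)
      (by rw [Ne, ENNReal.ofReal_eq_zero, not_le]; positivity)
  choose g hg hgL using hex
  have hlim : Tendsto (fun n => eLpNorm (⇑(g n) - h) 1 volume) atTop (𝓝 0) := by
    have h1 : Tendsto (fun n : ℕ => ENNReal.ofReal (1 / ((n : ℝ) + 1))) atTop (𝓝 0) := by
      simpa using ENNReal.tendsto_ofReal tendsto_one_div_add_atTop_nhds_zero_nat
    refine tendsto_of_tendsto_of_tendsto_of_le_of_le tendsto_const_nhds h1
      (fun _ => zero_le) (fun n => ?_)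
    rw [← eLpNorm_neg, neg_sub]
    exact hg n
  obtain ⟨ns, -, hns⟩ := (tendstoInMeasure_of_tendsto_eLpNorm (by norm_num)
    (fun n => (hgL n).1) hm hlim).exists_seq_tendsto_ae
  -- The radial retraction of `ℂ` onto the closed disc of radius `c`. Composing with it restores the
  -- bound `c`, which `L¹` approximation loses, and it fixes the values of `h`.
  have hr : Continuous fun z : ℂ => (c / max c ‖z‖) • z := by
    rcases hc.eq_or_lt with rfl | hc'
    · simpa using continuous_const
    · exact (continuous_const.div (continuous_const.max continuous_norm)
        fun z => (lt_max_of_lt_left hc').ne').smul continuous_id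
  have hrz : ∀ z : ℂ, ‖z‖ ≤ c → (c / max c ‖z‖) • z = z := by
    intro z hz
    rcases hc.eq_or_lt with rfl | hc'
    · simp [norm_le_zero_iff.mp hz]
    · rw [max_eq_left hz, div_self hc'.ne', one_smul]
  refine ⟨fun n => ⟨fun x => (c / max c ‖g (ns n) x‖) • g (ns n) x,
    hr.comp (g (ns n)).continuous⟩, fun n => ?_, ?_⟩
  · refine (ContinuousMap.norm_le _ hc).mpr fun x => ?_
    change ‖(c / max c ‖g (ns n) x‖) • g (ns n) x‖ ≤ c
    have hmax : 0 ≤ max c ‖g (ns n) x‖ := le_max_of_le_left hc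
    rw [norm_smul, Real.norm_of_nonneg (div_nonneg hc hmax), div_mul_eq_mul_div]
    exact div_le_of_le_mul₀ hmax hc (mul_le_mul_of_nonneg_left (le_max_right _ _) hc)
  · filter_upwards [hns, hb] with x hx hbx
    have h1 := (hr.tendsto (h x)).comp hx
    rw [hrz _ hbx] at h1
    exact h1

/-! ### The projectors on bounded measurable functions -/

namespace MRA

variable (A : MRA Ω p)

theorem integrable_phiDual (j : ℕ) (k : Fin (A.N j + 1)) : Integrable (A.phiDual j k) volume :=
  (A.phiDual_memLp_two j k).integrable (by norm_num)

theorem integrable_conj_phiDual (j : ℕ) (k : Fin (A.N j + 1)) :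
    Integrable (fun x => conj (A.phiDual j k x)) volume :=
  Complex.conjLIE.toContinuousLinearEquiv.toContinuousLinearMap.integrable_comp
    (A.integrable_phiDual j k)

theorem integrable_pairing_of_memLp_top (j : ℕ) (k : Fin (A.N j + 1)) {f : Ω → ℂ}
    (hf : MemLp f ∞ volume) : Integrable (fun x => f x * conj (A.phiDual j k x)) volume := by
  refine (A.integrable_conj_phiDual j k).bdd_mul (c := (eLpNorm f ∞ volume).toReal) hf.1 ?_
  filter_upwards [enorm_ae_le_eLpNormEssSup f volume] with x hx
  rw [← eLpNorm_exponent_top] at hx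
  simpa using ENNReal.toReal_mono hf.2.ne hx

theorem proj_sub (j : ℕ) {f g : Ω → ℂ} (hf : MemLp f ∞ volume) (hg : MemLp g ∞ volume) :
    A.proj j (f - g) = A.proj j f - A.proj j g := by
  simp only [proj, ← Finset.sum_sub_distrib, ← sub_smul]
  refine Finset.sum_congr rfl fun k _ => ?_
  congr 1
  simp only [pairing, Pi.sub_apply, sub_mul]
  exact integral_sub (A.integrable_pairing_of_memLp_top j k hf)
    (A.integrable_pairing_of_memLp_top j k hg)

theorem proj_mem (j : ℕ) (f : Ω → ℂ) : A.proj j f ∈ A.V j := by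
  rw [← A.span_eq j]
  exact Submodule.sum_mem _ fun k _ => Submodule.smul_mem _ _ (Submodule.subset_span ⟨k, rfl⟩)

theorem proj_eq_self (j : ℕ) {f : C(Ω, ℂ)} (hf : f ∈ A.V j) : A.proj j f = f := by
  rw [← A.projL_apply]
  rw [← A.span_eq j] at hf
  have h : Set.EqOn (A.projL j : C(Ω, ℂ) →ₗ[ℂ] C(Ω, ℂ))
      (LinearMap.id : C(Ω, ℂ) →ₗ[ℂ] C(Ω, ℂ))
      (Set.range fun k => toComplex (A.phi j k)) := by
    rintro _ ⟨k, rfl⟩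
    change A.projL j (toComplex (A.phi j k)) = toComplex (A.phi j k)
    rw [A.projL_apply, proj]
    simp [A.biorthogonal]
  exact LinearMap.eqOn_span h hf

/-- The operator norm of `P_j` on `C(Ω)` also bounds `P_j` on `L^∞(Ω)`. -/
theorem norm_proj_le (j : ℕ) {h : Ω → ℂ} (hm : AEStronglyMeasurable h volume) {c : ℝ}
    (hc : 0 ≤ c) (hb : ∀ᵐ x, ‖h x‖ ≤ c) : ‖A.proj j h‖ ≤ ‖A.projL j‖ * c := by
  -- The operator norm only sees continuous functions. Dominated convergence, with majorant `c
  -- |φ~|`, carries the bound to `h` through the finitely many coefficients.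
  obtain ⟨g, hg, hlim⟩ := exists_seq_continuous_tendsto_ae hm hc hb
  have h1 : ∀ k, Tendsto (fun n => pairing (g n) (A.phiDual j k)) atTop
      (𝓝 (pairing h (A.phiDual j k))) := fun k => by
    refine tendsto_integral_of_dominated_convergence (fun x => c * ‖A.phiDual j k x‖)
      (fun n => (A.integrable_pairing j k (g n)).1) ((A.integrable_phiDual j k).norm.const_mul c)
      (fun n => Eventually.of_forall fun x => ?_) ?_
    · rw [norm_mul, RCLike.norm_conj]
      exact mul_le_mul_of_nonneg_right (((g n).norm_coe_le_norm x).trans (hg n)) (norm_nonneg _)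
    · filter_upwards [hlim] with x hx
      exact hx.mul_const _
  have h2 : Tendsto (fun n => A.proj j (g n)) atTop (𝓝 (A.proj j h)) :=
    tendsto_finsetSum _ fun k _ => (h1 k).smul_const _
  refine le_of_tendsto h2.norm (Eventually.of_forall fun n => ?_)
  rw [← A.projL_apply]
  exact (A.projL j).le_of_opNorm_le_of_le le_rfl (hg n)

end MRA

end BoundedSampling

/-! ### Quasi-interpolation by a partition of unity -/

namespace BoundedSampling

open TopologicalSpace (Compacts)

variable {d : ℕ} {Ω : Compacts (Euc d)} {p : ℝ≥0∞} {M : ℕ} {Δ : ℝ} {X : Fin (M + 1) → Ω}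
  {ψ : Fin (M + 1) → Ω → ℝ}

/-- The step function `∑_l y_l ψ_l`. -/
def combination (ψ : Fin (M + 1) → Ω → ℝ) (y : Fin (M + 1) → ℂ) : Ω → ℂ :=
  fun x => ∑ l, y l * (ψ l x : ℂ)

theorem IsPartition.aestronglyMeasurable_ofReal (hψ : IsPartition Δ X ψ) (l : Fin (M + 1)) :
    AEStronglyMeasurable (fun x => (ψ l x : ℂ)) volume :=
  Complex.continuous_ofReal.comp_aestronglyMeasurable (hψ.aestronglyMeasurable l)

theorem IsPartition.memLp_top_ofReal (hψ : IsPartition Δ X ψ) (l : Fin (M + 1)) :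
    MemLp (fun x => (ψ l x : ℂ)) ∞ volume := by
  refine memLp_top_of_bound (hψ.aestronglyMeasurable_ofReal l) 1 ?_
  filter_upwards [hψ.mem_Icc l] with x hx
  rw [Complex.norm_real, Real.norm_of_nonneg hx.1]
  exact hx.2

theorem IsPartition.memLp_top_combination (hψ : IsPartition Δ X ψ) (y : Fin (M + 1) → ℂ) :
    MemLp (combination ψ y) ∞ volume :=
  memLp_finsetSum _ fun l _ => (hψ.memLp_top_ofReal l).const_mul (y l)

/-- A function differs from its quasi-interpolant by at most its oscillation. -/
theorem IsPartition.norm_sub_combination_le (hψ : IsPartition Δ X ψ) (y : Fin (M + 1) → ℂ)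
    (g : Ω → ℂ) {c : ℝ}
    (hy : ∀ l (x : Ω), (x : Euc d) ∈ Metric.ball (X l : Euc d) Δ⁻¹ → ‖g x - y l‖ ≤ c) :
    ∀ᵐ x, ‖g x - combination ψ y x‖ ≤ c := by
  filter_upwards [ae_all_iff.mpr hψ.mem_Icc, ae_all_iff.mpr hψ.support, hψ.sum_eq_one]
    with x h1 h2 h3
  have h4 : g x - combination ψ y x = ∑ l, (g x - y l) * (ψ l x : ℂ) := by
    simp only [sub_mul, Finset.sum_sub_distrib, ← Finset.mul_sum, ← Complex.ofReal_sum, h3,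
      combination, Complex.ofReal_one, mul_one]
  rw [h4]
  calc ‖∑ l, (g x - y l) * (ψ l x : ℂ)‖ ≤ ∑ l, ‖(g x - y l) * (ψ l x : ℂ)‖ := norm_sum_le _ _
    _ ≤ ∑ l, c * ψ l x := by
        refine Finset.sum_le_sum fun l _ => ?_
        rw [norm_mul, Complex.norm_real, Real.norm_of_nonneg (h1 l).1]
        by_cases h0 : ψ l x = 0
        · simp [h0]
        · exact mul_le_mul_of_nonneg_right (hy l x (h2 l h0)) (h1 l).1
    _ = c := by rw [← Finset.mul_sum, h3, mul_one]

theorem IsPartition.norm_combination_le (hψ : IsPartition Δ X ψ) (y : Fin (M + 1) → ℂ) {c : ℝ}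
    (hy : ∀ l, ‖y l‖ ≤ c) : ∀ᵐ x, ‖combination ψ y x‖ ≤ c := by
  -- The oscillation estimate against the zero function bounds the combination itself.
  filter_upwards [hψ.norm_sub_combination_le y 0 (c := c) (fun l x _ => by simpa using hy l)]
    with x hx
  simpa using hx

theorem toComplex_uniformContinuous (u : C(Ω, ℝ)) : UniformContinuous (toComplex u) :=
  CompactSpace.uniformContinuous_of_continuous (toComplex u).continuous

/-! ### The procedure as an iteration in `V_j` -/

namespace MRA

variable (A : MRA Ω p) (j : ℕ)

/-- `P_j (∑_l y_l ψ_l)`, with coefficients given by the matrix `M_{ψ φ~}`. -/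
noncomputable def recon (ψ : Fin (M + 1) → Ω → ℝ) (y : Fin (M + 1) → ℂ) : C(Ω, ℂ) :=
  ∑ k, (A.psiMatrix j ψ).mulVec y k • toComplex (A.phi j k)

theorem recon_add (y z : Fin (M + 1) → ℂ) :
    A.recon j ψ (y + z) = A.recon j ψ y + A.recon j ψ z := by
  simp only [recon, Matrix.mulVec_add, Pi.add_apply, add_smul, Finset.sum_add_distrib]

theorem recon_sub (y z : Fin (M + 1) → ℂ) :
    A.recon j ψ (y - z) = A.recon j ψ y - A.recon j ψ z := by
  simp only [recon, Matrix.mulVec_sub, Pi.sub_apply, sub_smul, Finset.sum_sub_distrib]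

theorem recon_mem (y : Fin (M + 1) → ℂ) : A.recon j ψ y ∈ A.V j := by
  rw [← A.span_eq j]
  exact Submodule.sum_mem _ fun k _ => Submodule.smul_mem _ _ (Submodule.subset_span ⟨k, rfl⟩)

theorem proj_combination (hψ : IsPartition Δ X ψ) (y : Fin (M + 1) → ℂ) :
    A.proj j (combination ψ y) = A.recon j ψ y := by
  refine Finset.sum_congr rfl fun k _ => ?_
  congr 1
  simp only [pairing, combination, Finset.sum_mul, mul_assoc, Matrix.mulVec, dotProduct,
    psiMatrix, Matrix.of_apply]
  rw [integral_finsetSum _ fun l _ =>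
    (A.integrable_pairing_of_memLp_top j k (hψ.memLp_top_ofReal l)).const_mul (y l)]
  refine Finset.sum_congr rfl fun l _ => ?_
  rw [integral_const_mul, mul_comm]

theorem norm_recon_le (hψ : IsPartition Δ X ψ) (y : Fin (M + 1) → ℂ) {c : ℝ} (hc : 0 ≤ c)
    (hy : ∀ l, ‖y l‖ ≤ c) : ‖A.recon j ψ y‖ ≤ ‖A.projL j‖ * c := by
  rw [← A.proj_combination j hψ]
  exact A.norm_proj_le j (hψ.memLp_top_combination y).1 hc (hψ.norm_combination_le y hy)

/-- With `pqs_eq`, this turns the matrix products of the procedure into integration and sampling of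
one function in `V_j`. -/
theorem quad_eq (y : Fin (M + 1) → ℂ) : A.quad j ψ y = integralL Ω (A.recon j ψ y) := by
  simp only [recon, map_sum, map_smul, quad, dotProduct, omega, smul_eq_mul]
  exact Finset.sum_congr rfl fun k _ => mul_comm _ _

theorem pqs_eq (y : Fin (M + 1) → ℂ) : A.pqs j X ψ y = fun l => A.recon j ψ y (X l) := by
  ext l
  simp only [recon, ContinuousMap.sum_apply, ContinuousMap.smul_apply, smul_eq_mul, pqs,
    Matrix.mulVec, dotProduct, phiMatrix, Matrix.of_apply]
  exact Finset.sum_congr rfl fun k _ => mul_comm _ _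

/-- The elements of `V_j` whose integrals and samples are the variables of the procedure. -/
noncomputable def iterate (X : Fin (M + 1) → Ω) (ψ : Fin (M + 1) → Ω → ℝ) (y : Fin (M + 1) → ℂ) :
    ℕ → C(Ω, ℂ)
  | 0 => A.recon j ψ y
  | i + 1 => iterate X ψ y i + A.recon j ψ (y - fun l => iterate X ψ y i (X l))

theorem iterate_mem (y : Fin (M + 1) → ℂ) (i : ℕ) : A.iterate j X ψ y i ∈ A.V j := by
  induction i with
  | zero => exact A.recon_mem j y
  | succ i ih => exact Submodule.add_mem _ ih (A.recon_mem j _)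

theorem state_eq (y : Fin (M + 1) → ℂ) (i : ℕ) : A.state j X ψ y i =
    (integralL Ω (A.iterate j X ψ y i), fun l => A.iterate j X ψ y i (X l)) := by
  induction i with
  | zero => simp only [state, iterate, quad_eq, pqs_eq]
  | succ i ih =>
    simp only [state, iterate, ih, quad_eq, pqs_eq, map_add]
    rfl

/-- On `V_j` the procedure converges geometrically, and its limit is close to the `V_j`-part `q`
of the sampled function `q + e` if the remainder `e` is small. -/
theorem tendsto_iterate (hψ : IsPartition Δ X ψ) {η : ℝ} (hη : η ∈ Set.Ioo (0 : ℝ) 1)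
    (hA : A.Contracts j X ψ η) {q : C(Ω, ℂ)} (hq : q ∈ A.V j) (e : C(Ω, ℂ)) :
    ∃ w : C(Ω, ℂ), Tendsto (A.iterate j X ψ fun l => (q + e) (X l)) atTop (𝓝 (q + w)) ∧
      ‖w‖ ≤ ‖A.projL j‖ * ‖e‖ / (1 - η) := by
  set y : Fin (M + 1) → ℂ := fun l => (q + e) (X l)
  set u := A.iterate j X ψ y
  have hT : ∀ f ∈ A.V j, ‖f - A.recon j ψ (fun l => f (X l))‖ ≤ η * ‖f‖ := fun f hf => by
    have h := hA f hf
    have h2 : quasiInterp X ψ ⇑f = combination ψ (fun l => f (X l)) := rfl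
    rwa [h2, A.proj_combination j hψ] at h
  have hu : ∀ i, u (i + 1) = u i + (A.recon j ψ y - A.recon j ψ fun l => u i (X l)) := fun i => by
    rw [← A.recon_sub]; rfl
  have hy : A.recon j ψ y = A.recon j ψ (fun l => q (X l)) + A.recon j ψ (fun l => e (X l)) := by
    rw [← A.recon_add]; rfl
  have hsub : ∀ f g : C(Ω, ℂ), A.recon j ψ (fun l => (f - g) (X l)) =
      A.recon j ψ (fun l => f (X l)) - A.recon j ψ (fun l => g (X l)) := fun f g => by
    rw [← A.recon_sub]; rfl
  -- Successive increments are related by `I - R S`, where `R` is `recon` and `S` is sampling; the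
  -- input `y` cancels.
  have hstep : ∀ i, ‖u (i + 1 + 1) - u (i + 1)‖ ≤ η * ‖u (i + 1) - u i‖ := fun i => by
    have h := hT (u (i + 1) - u i)
      (Submodule.sub_mem _ (A.iterate_mem j y _) (A.iterate_mem j y _))
    rw [hsub] at h
    convert h using 2
    rw [hu (i + 1), hu i]
    abel_nf
  have hgeo : ∀ i, dist (u i) (u (i + 1)) ≤ ‖u 1 - u 0‖ * η ^ i := fun i => by
    rw [dist_comm, dist_eq_norm]
    induction i with
    | zero => simp
    | succ i ih =>
      refine (hstep i).trans ((mul_le_mul_of_nonneg_left ih hη.1.le).trans_eq ?_)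
      ring
  obtain ⟨v, hv⟩ := cauchySeq_tendsto_of_complete (cauchySeq_of_le_geometric η _ hη.2 hgeo)
  refine ⟨v - q, by rwa [add_sub_cancel], ?_⟩
  -- The error against `q` obeys the same contraction, perturbed by the reconstruction of the
  -- samples of `e`.
  have hB : ∀ i, ‖u (i + 1) - q‖ ≤ η * ‖u i - q‖ + ‖A.projL j‖ * ‖e‖ := fun i => by
    have h := hT (u i - q) (Submodule.sub_mem _ (A.iterate_mem j y _) hq)
    have he := A.norm_recon_le j hψ (fun l => e (X l)) (norm_nonneg e)
      fun l => e.norm_coe_le_norm (X l)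
    have h2 : u (i + 1) - q = (u i - q - A.recon j ψ (fun l => (u i - q) (X l))) +
        A.recon j ψ (fun l => e (X l)) := by
      rw [hu, hsub, hy]
      abel
    rw [h2]
    exact (norm_add_le _ _).trans (add_le_add h he)
  have hv' : Tendsto (fun i => ‖u i - q‖) atTop (𝓝 ‖v - q‖) := (hv.sub_const q).norm
  -- In the limit, `‖w‖ ≤ η ‖w‖ + ‖P_j‖ ‖e‖`, which is solved for `‖w‖`.
  have hlim := le_of_tendsto_of_tendsto' (hv'.comp (tendsto_add_atTop_nat 1))
    ((hv'.const_mul η).add_const _) hB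
  rw [le_div_iff₀ (by linarith [hη.2])]
  linarith

theorem tendsto_integrate (hψ : IsPartition Δ X ψ) {η : ℝ} (hη : η ∈ Set.Ioo (0 : ℝ) 1)
    (hA : A.Contracts j X ψ η) {q : C(Ω, ℂ)} (hq : q ∈ A.V j) (e : C(Ω, ℂ)) :
    ∃ I : ℂ, Tendsto (fun n => A.integrate j X ψ n fun l => (q + e) (X l)) atTop (𝓝 I) ∧
      ‖I - ∫ x, q x‖ ≤
        volume.real (Ω : Set (Euc d)) * (‖A.projL j‖ * ‖e‖ / (1 - η)) := by
  obtain ⟨w, hw, hwn⟩ := A.tendsto_iterate j hψ hη hA hq e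
  refine ⟨integralL Ω (q + w), ?_, ?_⟩
  -- The shift by one reflects that `INTEGRATE[n, y]` passes through the loop `n + 1` times.
  · have h := ((integralL Ω).continuous.tendsto _).comp (hw.comp (tendsto_add_atTop_nat 1))
    refine h.congr fun n => ?_
    simp only [integrate, state_eq, Function.comp_apply]
  · rw [← integralL_apply, ← map_sub, add_sub_cancel_left]
    exact (norm_integral_coe_le w).trans (mul_le_mul_of_nonneg_left hwn measureReal_nonneg)

/-! ### The contraction property for dense nodes -/

/-- The elements of the unit ball of the finite-dimensional space `V_j` are equicontinuous. -/
theorem exists_equicontinuous {ε : ℝ} (hε : 0 < ε) :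
    ∃ δ > 0, ∀ f ∈ A.V j, ∀ x y : Ω, dist x y < δ → ‖f x - f y‖ ≤ ε * ‖f‖ := by
  -- The basis coefficients of `f` sum in modulus to at most `K ‖f‖`, so it is enough to control the
  -- oscillation of finitely many basis functions. Dividing by `K + 1` avoids a zero denominator.
  set K : ℝ := ∑ k, ‖A.coeffL j k‖ with hK
  have hK0 : 0 ≤ K := Finset.sum_nonneg fun k _ => norm_nonneg _
  have hε' : 0 < ε / (K + 1) := by positivity
  have h1 : ∀ k, ∃ δ > 0, ∀ x y : Ω, dist x y < δ →
      dist (toComplex (A.phi j k) x) (toComplex (A.phi j k) y) < ε / (K + 1) := fun k => by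
    obtain ⟨δ, hδ, h⟩ := Metric.uniformContinuous_iff.mp
      (toComplex_uniformContinuous (A.phi j k)) _ hε'
    exact ⟨δ, hδ, fun x y hxy => h hxy⟩
  choose δ hδ h using h1
  refine ⟨Finset.univ.inf' Finset.univ_nonempty δ, (Finset.lt_inf'_iff _).mpr fun k _ => hδ k,
    fun f hf x y hxy => ?_⟩
  have hrep : ∀ z, f z = ∑ k, A.coeffL j k f * toComplex (A.phi j k) z := fun z => by
    conv_lhs => rw [← A.proj_eq_self j hf, proj, ContinuousMap.sum_apply]
    rfl
  rw [hrep x, hrep y, ← Finset.sum_sub_distrib]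
  calc ‖∑ k, (A.coeffL j k f * toComplex (A.phi j k) x -
          A.coeffL j k f * toComplex (A.phi j k) y)‖
      ≤ ∑ k, ‖A.coeffL j k‖ * ‖f‖ * (ε / (K + 1)) := by
        refine norm_sum_le_of_le _ fun k _ => ?_
        rw [← mul_sub, norm_mul, ← dist_eq_norm (toComplex (A.phi j k) x)]
        exact mul_le_mul ((A.coeffL j k).le_opNorm f)
          (h k x y ((Finset.lt_inf'_iff _).mp hxy k (Finset.mem_univ k))).le dist_nonneg
          (by positivity)
    _ = K * (ε / (K + 1)) * ‖f‖ := by rw [← Finset.sum_mul, ← Finset.sum_mul]; ring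
    _ ≤ ε * ‖f‖ := by
        refine mul_le_mul_of_nonneg_right ?_ (norm_nonneg f)
        rw [mul_div_assoc', div_le_iff₀ (by positivity)]
        nlinarith

/-- For dense sampling points the quasi-interpolation is a contraction on `V_j`. -/
theorem exists_contracts {η : ℝ} (hη : 0 < η) :
    ∃ Δ₀ > 0, ∀ Δ, Δ₀ ≤ Δ → ∀ (M : ℕ) (X : Fin (M + 1) → Ω) (ψ : Fin (M + 1) → Ω → ℝ),
      IsPartition Δ X ψ → A.Contracts j X ψ η := by
  have hP : 0 < ‖A.projL j‖ + 1 := by positivity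
  obtain ⟨δ, hδ, h⟩ := A.exists_equicontinuous j (div_pos hη hP)
  refine ⟨δ⁻¹, inv_pos.mpr hδ, fun Δ hΔ M X ψ hψ f hf => ?_⟩
  have hΔ' : Δ⁻¹ ≤ δ := inv_le_of_inv_le₀ hδ hΔ
  have hfm : MemLp (⇑f) ∞ (volume : Measure Ω) :=
    memLp_top_of_bound f.continuous.aestronglyMeasurable _ (Eventually.of_forall f.norm_coe_le_norm)
  have hQ := hψ.memLp_top_combination fun l => f (X l)
  -- Since `P_j f = f`, the defect is the projection of the quasi-interpolation error, which is
  -- small by equicontinuity.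
  have h1 : f - A.proj j (quasiInterp X ψ f) =
      A.proj j (⇑f - combination ψ fun l => f (X l)) := by
    rw [A.proj_sub j hfm hQ, A.proj_eq_self j hf]
    rfl
  rw [h1]
  refine (A.norm_proj_le j (hfm.sub hQ).1 (c := η / (‖A.projL j‖ + 1) * ‖f‖) (by positivity)
    (hψ.norm_sub_combination_le _ _ fun l x hx => h f hf _ _ (lt_of_lt_of_le hx hΔ'))).trans ?_
  rw [← mul_assoc]
  refine mul_le_mul_of_nonneg_right ?_ (norm_nonneg f)
  rw [mul_div_assoc', div_le_iff₀ hP]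
  nlinarith [norm_nonneg (A.projL j)]

end MRA

end BoundedSampling

/-! ### Wavelet remainders of `H^s` functions -/

namespace BoundedSampling

open TopologicalSpace (Compacts)

variable {d : ℕ} {Ω : Compacts (Euc d)} {p : ℝ≥0∞}

namespace MRA

namespace WaveletBasis

variable {A : MRA Ω p} (W : A.WaveletBasis)

/-- The component `∑_k ⟨f, Ψ~_{j,k}⟩ Ψ_{j,k}` of `f`. -/
noncomputable def level (f : Ω → ℂ) (j : ℕ) : C(Ω, ℂ) :=
  ∑ k, pairing f (W.psiDual j k) • W.psi j k

theorem levelEnergy_nonneg (s : ℝ) (f : Ω → ℂ) (j : ℕ) : 0 ≤ W.levelEnergy s f j := by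
  unfold levelEnergy
  positivity

theorem integralL_level (h4 : W.W4) (f : Ω → ℂ) (j : ℕ) : integralL Ω (W.level f j) = 0 := by
  rw [level, map_sum]
  refine Finset.sum_eq_zero fun k _ => ?_
  rw [map_smul, integralL_apply, h4, smul_zero]

/-- Cauchy-Schwarz over `k`: the sup norms of the wavelets and the square root of their number each
contribute `2^{dj/2}`, and the weight in the energy gives `2^{-sj}`. The absolute values are there
because the constants carry no sign assumption. -/
theorem norm_level_le {CΨ CJ : ℝ} (h3 : W.W3 CΨ CJ) (s : ℝ) (f : Ω → ℂ) (j : ℕ) :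
    ‖W.level f j‖ ≤ |CΨ| * √|CJ| * ((2 : ℝ) ^ (3 * (d : ℝ) / 2 - s)) ^ j *
      √(W.levelEnergy s f j) := by
  set a : ℝ := (2 : ℝ) ^ ((d : ℝ) * j / 2) with ha
  set E : ℝ := ∑ k, ‖pairing f (W.psiDual j k)‖ ^ 2 with hE
  have ha0 : 0 < a := by positivity
  have haa : a * a = (2 : ℝ) ^ ((d : ℝ) * j) := by
    rw [ha, ← Real.rpow_add two_pos]; congr 1; ring
  have ha1 : 1 ≤ a := Real.one_le_rpow one_le_two (by positivity)
  have h1 : ‖W.level f j‖ ≤ (∑ k, ‖pairing f (W.psiDual j k)‖) * (|CΨ| * a) := by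
    rw [Finset.sum_mul]
    refine norm_sum_le_of_le _ fun k _ => ?_
    rw [norm_smul]
    exact mul_le_mul_of_nonneg_left ((h3.1 j k).trans
      (mul_le_mul_of_nonneg_right (le_abs_self _) ha0.le)) (norm_nonneg _)
  have h2 : ∑ k, ‖pairing f (W.psiDual j k)‖ ≤ √|CJ| * a * √E := by
    have hcs := sq_sum_le_card_mul_sum_sq (s := Finset.univ)
      (f := fun k => ‖pairing f (W.psiDual j k)‖)
    rw [Finset.card_univ, Fintype.card_fin] at hcs
    have hcard : (W.card j : ℝ) ≤ |CJ| * (a * a) := by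
      rw [haa]
      exact (h3.2 j).trans (mul_le_mul_of_nonneg_right (le_abs_self _) (by positivity))
    have hE0 : 0 ≤ E := by positivity
    refine le_of_sq_le_sq ?_ (by positivity)
    rw [mul_pow, mul_pow, Real.sq_sqrt (abs_nonneg _), Real.sq_sqrt hE0, sq a]
    exact hcs.trans (mul_le_mul_of_nonneg_right hcard hE0)
  have h5 : √(W.levelEnergy s f j) = (2 : ℝ) ^ (s * j) * √E := by
    have h6 : (2 : ℝ) ^ (2 * s * j) = ((2 : ℝ) ^ (s * j)) ^ 2 := by
      rw [sq, ← Real.rpow_add two_pos]; congr 1; ring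
    rw [levelEnergy, h6, Real.sqrt_mul (by positivity), Real.sqrt_sq (by positivity)]
  have h7 : ((2 : ℝ) ^ (3 * (d : ℝ) / 2 - s)) ^ j * (2 : ℝ) ^ (s * j) = a * a * a := by
    rw [haa, ha, ← Real.rpow_natCast, ← Real.rpow_mul two_pos.le, ← Real.rpow_add two_pos,
      ← Real.rpow_add two_pos]
    congr 1; ring
  calc ‖W.level f j‖ ≤ √|CJ| * a * √E * (|CΨ| * a) :=
        h1.trans (mul_le_mul_of_nonneg_right h2 (by positivity))
    _ = |CΨ| * √|CJ| * (a * a * 1) * √E := by ring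
    -- The argument gives the exponent `d - s`; the extra factor `a = 2^{dj/2} ≥ 1` weakens it to
    -- the stated `3d/2 - s`.
    _ ≤ |CΨ| * √|CJ| * (a * a * a) * √E := by gcongr
    _ = _ := by rw [h5, ← h7]; ring

/-- Functions in `H^s(Ω)` are sums of uniformly convergent wavelet series whose remainders have
mean zero and decay geometrically. -/
theorem exists_remainder {s : ℝ} (hs : 3 * (d : ℝ) / 2 < s) {c₁ c₂ CΨ CJ : ℝ} {J : ℕ}
    (h2 : W.W2 s c₁ c₂ J) (h3 : W.W3 CΨ CJ) (h4 : W.W4) {f : Ω → ℂ} (hf : MemHs s f) :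
    ∃ e : C(Ω, ℂ), ⇑(A.proj J f + e) =ᵐ[volume] f ∧ ∫ x, e x = 0 ∧
      ‖e‖ ≤ |CΨ| * √|CJ| * ((2 : ℝ) ^ (3 * (d : ℝ) / 2 - s)) ^ J * (c₂ * hsNorm s f) *
        (1 - (2 : ℝ) ^ (3 * (d : ℝ) / 2 - s))⁻¹ := by
  set r : ℝ := (2 : ℝ) ^ (3 * (d : ℝ) / 2 - s) with hr
  have hr0 : 0 < r := by positivity
  have hr1 : r < 1 := Real.rpow_lt_one_of_one_lt_of_neg one_lt_two (by linarith)
  have hfL := memLp_of_memHs hf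
  obtain ⟨-, -, hW⟩ := h2
  have hsum := (hW f hfL).1.mp hf
  have hle := ((hW f hfL).2 hf).2
  -- Each level energy is bounded by the whole sum in W2. The geometric decay comes entirely from
  -- the factor in `norm_level_le`.
  have hen : ∀ i, √(W.levelEnergy s f (J + i)) ≤ c₂ * hsNorm s f := fun i =>
    (Real.sqrt_le_sqrt (hsum.le_tsum i fun k _ => W.levelEnergy_nonneg s f _)).trans
      ((le_add_of_nonneg_left ENNReal.toReal_nonneg).trans hle)
  have hb : ∀ i, ‖W.level f (J + i)‖ ≤
      |CΨ| * √|CJ| * r ^ J * (c₂ * hsNorm s f) * r ^ i := fun i => by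
    refine (W.norm_level_le h3 s f (J + i)).trans ?_
    calc |CΨ| * √|CJ| * r ^ (J + i) * √(W.levelEnergy s f (J + i))
        ≤ |CΨ| * √|CJ| * r ^ (J + i) * (c₂ * hsNorm s f) :=
          mul_le_mul_of_nonneg_left (hen i) (by positivity)
      _ = _ := by rw [pow_add]; ring
  have hg := (hasSum_geometric_of_lt_one hr0.le hr1).mul_left
    (|CΨ| * √|CJ| * r ^ J * (c₂ * hsNorm s f))
  have he : HasSum (fun i => W.level f (J + i)) (∑' i, W.level f (J + i)) :=
    (Summable.of_norm_bounded hg.summable hb).hasSum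
  refine ⟨∑' i, W.level f (J + i), ?_, ?_, tsum_of_norm_bounded hg hb⟩
  · have hS : Tendsto (fun n => A.proj J f + ∑ j ∈ Finset.Ico J n, W.level f j) atTop
        (𝓝 (A.proj J f + ∑' i, W.level f (J + i))) := by
      refine tendsto_const_nhds.add ?_
      simp only [Finset.sum_Ico_eq_sum_range]
      exact he.tendsto_sum_nat.comp (tendsto_sub_atTop_nat J)
    -- The partial sums converge uniformly by the geometric bound and to `f` in `L²` by W1, so the
    -- two limits agree almost everywhere.
    exact ae_eq_of_tendsto hfL.1 hS (W.expansion J f hfL)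
  · rw [← integralL_apply]
    have h := (integralL Ω).hasSum he
    simp only [W.integralL_level h4] at h
    exact h.unique hasSum_zero

end WaveletBasis

end MRA

end BoundedSampling

/-! ### Assembly of the error estimate -/

theorem mainTheorem7 (d : ℕ) (s : ℝ) (hs : 3 * (d : ℝ) / 2 < s) (c₂ CΨ CJ : ℝ) :
    ∃ C : ℝ, 0 < C ∧
      ∀ (Ω : TopologicalSpace.Compacts (Euc d)),
      closure (interior (Ω : Set (Euc d))) = (Ω : Set (Euc d)) →
      ∀ (p : ℝ≥0∞), 1 < p → p < ∞ →
      ∀ (A : BoundedSampling.MRA Ω p) (W : A.WaveletBasis), W.W3 CΨ CJ → W.W4 →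
      ∀ (J : ℕ) (c₁ : ℝ), W.W2 s c₁ c₂ J →
      ∃ Δ₀ : ℝ, 0 < Δ₀ ∧ ∃ η₀ ∈ Set.Ioo (0 : ℝ) 1,
        ∀ Δ : ℝ, Δ₀ ≤ Δ → ∀ (M : ℕ) (X : Fin (M + 1) → Ω) (ψ : Fin (M + 1) → Ω → ℝ),
        BoundedSampling.IsDeltaDense Δ X → BoundedSampling.IsPartition Δ X ψ →
        A.Contracts J X ψ η₀ ∧
        ∀ η ∈ Set.Ioo (0 : ℝ) 1, A.Contracts J X ψ η →
        ∀ f : Ω → ℂ, BoundedSampling.MemHs s f →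
          (∃ g : C(Ω, ℂ), ⇑g =ᵐ[volume] f) ∧
          ∀ g : C(Ω, ℂ), ⇑g =ᵐ[volume] f →
            ∃ I : ℂ, Tendsto (fun n => A.integrate J X ψ n (fun l => g (X l))) atTop (𝓝 I) ∧
              ‖I - ∫ x, f x‖ ≤
                C * (volume.real (Ω : Set (Euc d)) * ‖A.projL J‖ / (1 - η)) *
                  BoundedSampling.hsNorm s f *
                  ((2 : ℝ) ^ ((3 * (d : ℝ) / 2 - s) * ((J : ℝ) + 1)) /
                    (1 - (2 : ℝ) ^ (3 * (d : ℝ) / 2 - s))) := by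
  have hr0 : 0 < (2 : ℝ) ^ (3 * (d : ℝ) / 2 - s) := by positivity
  have hr1 : (2 : ℝ) ^ (3 * (d : ℝ) / 2 - s) < 1 :=
    Real.rpow_lt_one_of_one_lt_of_neg one_lt_two (by linarith)
  have hpow : ∀ J : ℕ, (2 : ℝ) ^ ((3 * (d : ℝ) / 2 - s) * ((J : ℝ) + 1)) =
      ((2 : ℝ) ^ (3 * (d : ℝ) / 2 - s)) ^ (J + 1) := fun J => by
    rw [← Real.rpow_natCast, ← Real.rpow_mul two_pos.le]
    push_cast
    rfl
  set r : ℝ := (2 : ℝ) ^ (3 * (d : ℝ) / 2 - s)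
  -- The factor `r⁻¹` converts the `r ^ J` of the remainder bound into the stated `r ^ (J + 1)`; the
  -- summand `1` keeps the constant positive even if one of the given constants vanishes.
  refine ⟨|CΨ| * √|CJ| * |c₂| * r⁻¹ + 1, by positivity, ?_⟩
  intro Ω hΩ p _ _ A W h3 h4 J c₁ h2
  obtain ⟨Δ₀, hΔ₀, hcontr⟩ := A.exists_contracts J (η := 1 / 2) (by norm_num)
  refine ⟨Δ₀, hΔ₀, 1 / 2, by norm_num, fun Δ hΔ M X ψ _ hψ => ⟨hcontr Δ hΔ M X ψ hψ, ?_⟩⟩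
  intro η hη hA f hf
  obtain ⟨e, hfe, he0, hen⟩ := W.exists_remainder hs h2 h3 h4 hf
  refine ⟨⟨_, hfe⟩, fun g hg => ?_⟩
  have := BoundedSampling.isOpenPosMeasure hΩ
  -- Almost everywhere equality of continuous functions is equality here, so the samples of `g` are
  -- those of `P_J f + e`.
  have hge : g = A.proj J f + e := DFunLike.coe_injective <|
    (Continuous.ae_eq_iff_eq volume g.continuous (A.proj J f + e).continuous).mp
      (hg.trans hfe.symm)
  obtain ⟨I, hI, hIn⟩ := A.tendsto_integrate J hψ hη hA (A.proj_mem J f) e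
  refine ⟨I, by rwa [hge], ?_⟩
  -- The remainder has mean zero, so comparing with `∫ P_J f` loses nothing.
  have hint : ∫ x, f x = ∫ x, A.proj J f x := by
    rw [← integral_congr_ae hfe, ← BoundedSampling.integralL_apply, map_add,
      BoundedSampling.integralL_apply, BoundedSampling.integralL_apply, he0, add_zero]
  rw [hint, hpow]
  have hη' : 0 < 1 - η := sub_pos.mpr hη.2
  have hr' : 0 < 1 - r := sub_pos.mpr hr1
  have hH := BoundedSampling.hsNorm_nonneg s f
  refine hIn.trans ?_
  calc volume.real (Ω : Set (Euc d)) * (‖A.projL J‖ * ‖e‖ / (1 - η))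
      ≤ volume.real (Ω : Set (Euc d)) * (‖A.projL J‖ * (|CΨ| * √|CJ| * r ^ J *
          (|c₂| * BoundedSampling.hsNorm s f) * (1 - r)⁻¹) / (1 - η)) := by
        gcongr
        refine hen.trans ?_
        gcongr
        exact le_abs_self c₂
    _ = (|CΨ| * √|CJ| * |c₂| * r⁻¹) * (volume.real (Ω : Set (Euc d)) * ‖A.projL J‖ / (1 - η)) *
          BoundedSampling.hsNorm s f * (r ^ (J + 1) / (1 - r)) := by
        field_simp
        ring
    _ ≤ _ := by
        gcongr
        linarith
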